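/- For real $\nu$ and $x>0$ let $I_\nu(x)=\sum_{k=0}^\infty \frac{(x/2)^{2k+\nu}}{k!\,\Gamma(\nu+k+1)}$ and $K_\nu(x)=\int_0^\infty e^{-x\cosh t}\cosh(\nu t)\,dt$ be the modified Bessel functions of the first and second kind. Let $n\in\mathbb{N}=\{0,1,2,\ldots\}$ and let $\nu$ and $x$ be real with $\nu\ge -1/2$ and $x>0$. Then $$0<\frac{d^{2n}}{dx^{2n}}\left(\frac{K_\nu(x)}{x^\nu}\right)\le \frac{K_{\nu+2n}(x)}{x^\nu},\qquad -\frac{K_{\nu+2n+1}(x)}{x^\nu}\le\frac{d^{2n+1}}{dx^{2n+1}}\left(\frac{K_\nu(x)}{x^\nu}\right)<0,$$ and $$0<\frac{d^{n}}{dx^{n}}\left(\frac{I_\nu(x)}{x^\nu}\right)\le\begin{cases}x^{-\nu}I_{\nu+1}(x), & n \text{ odd},\\ x^{-\nu}I_\nu(x), & n\text{ even}.\end{cases}$$ -/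

import Mathlib

/-- The modified Bessel function of the first kind of real order `ν`, for `x > 0`:
`I_ν(x) = ∑_{k ≥ 0} (x/2)^(2k+ν) / (k! Γ(ν+k+1))`.
At the poles of `Γ` Mathlib's value `Γ = 0` together with `a / 0 = 0` gives the usual
convention `1/Γ = 0`. -/
noncomputable def besselI (ν x : ℝ) : ℝ :=
  ∑' k : ℕ, (x / 2) ^ (2 * (k : ℝ) + ν) / ((k.factorial : ℝ) * Real.Gamma (ν + (k : ℝ) + 1))

/-- The modified Bessel function of the second kind of real order `ν`, for `x > 0`:
`K_ν(x) = ∫_0^∞ exp(-x cosh t) cosh(ν t) dt`. -/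
noncomputable def besselK (ν x : ℝ) : ℝ :=
  ∫ t in Set.Ioi (0 : ℝ), Real.exp (-x * Real.cosh t) * Real.cosh (ν * t)

open Set Filter Topology MeasureTheory

/-! ### Iterated derivatives on the positive half-line -/

/-! Write f_ν = K_ν / x^ν. Then f_ν' = -x f_{ν+1} and f_ν'' = f_ν + (2ν+1) f_{ν+1}. As 2ν+1 ≥ 0,
two-step induction on the order of the derivative, over all ν at once, gives the signs
(`neg_one_pow_mul_besselKQuotDeriv_pos`) and, with the three-term recurrence `besselK_add_one_sub`,
the bounds (`neg_one_pow_mul_besselKQuotDeriv_le`).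

I_ν / x^ν is an exponential generating function ∑ c_j x^j / j!, so differentiation shifts c. The c_j
vanish for odd j and, for ν ≥ -1/2, are positive and decreasing along even j
(`besselICoeff_antitone`). Hence the n-th derivative is at most the one whose order is the parity of
n, and the first derivative is x^(-ν) I_{ν+1}. -/

theorem iteratedDeriv_eq_of_hasDerivAt_Ioi {f : ℝ → ℝ} {g : ℕ → ℝ → ℝ}
    (h0 : ∀ y, 0 < y → f y = g 0 y)
    (hg : ∀ n y, 0 < y → HasDerivAt (g n) (g (n + 1) y) y) (n : ℕ) :
    ∀ y, 0 < y → iteratedDeriv n f y = g n y := by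
  induction n with
  | zero => simpa using h0
  | succ n ih =>
    intro y hy
    have : iteratedDeriv n f =ᶠ[𝓝 y] g n := by
      filter_upwards [Ioi_mem_nhds hy] with z hz using ih z hz
    rw [iteratedDeriv_succ, this.deriv_eq, (hg n y hy).deriv]

/-! ### The function of the second kind -/

theorem sq_div_four_le_cosh {t : ℝ} (ht : 0 ≤ t) : t ^ 2 / 4 ≤ Real.cosh t := by
  rw [Real.cosh_eq]
  have := Real.quadratic_le_exp_of_nonneg ht
  have := Real.exp_pos (-t)
  linarith

theorem cosh_le_exp_abs (t : ℝ) : Real.cosh t ≤ Real.exp |t| := by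
  rw [← Real.cosh_abs, Real.cosh_eq]
  have : Real.exp (-|t|) ≤ Real.exp |t| := Real.exp_le_exp.2 (by linarith [abs_nonneg t])
  linarith

theorem besselK_integrand_le (ν : ℝ) {x t : ℝ} (hx : 0 < x) (ht : 0 ≤ t) :
    Real.exp (-x * Real.cosh t) * Real.cosh (ν * t)
      ≤ Real.exp ((|ν| + 1) ^ 2 / x) * Real.exp (-t) := by
  refine (mul_le_mul_of_nonneg_left (cosh_le_exp_abs _) (Real.exp_pos _).le).trans ?_
  rw [← Real.exp_add, ← Real.exp_add, Real.exp_le_exp, abs_mul, abs_of_nonneg ht]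
  have h1 : x * (t ^ 2 / 4) ≤ x * Real.cosh t :=
    mul_le_mul_of_nonneg_left (sq_div_four_le_cosh ht) hx.le
  -- The right side is the maximum over t, attained at t = 2(|ν| + 1)/x; the extra 1 pays for the
  -- factor `exp (-t)`.
  have h2 : (|ν| + 1) * t - x * (t ^ 2 / 4) ≤ (|ν| + 1) ^ 2 / x := by
    rw [le_div_iff₀ hx]
    nlinarith [sq_nonneg (|ν| + 1 - x * t / 2)]
  linarith

theorem integrableOn_besselK (ν : ℝ) {x : ℝ} (hx : 0 < x) :
    IntegrableOn (fun t => Real.exp (-x * Real.cosh t) * Real.cosh (ν * t)) (Ioi 0) := by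
  refine ((integrableOn_exp_neg_Ioi 0).const_mul (Real.exp ((|ν| + 1) ^ 2 / x))).mono'
    (by fun_prop) ?_
  filter_upwards [ae_restrict_mem measurableSet_Ioi] with t ht
  rw [Real.norm_of_nonneg (mul_pos (Real.exp_pos _) (Real.cosh_pos _)).le]
  exact besselK_integrand_le ν hx (le_of_lt ht)

theorem besselK_pos (ν : ℝ) {x : ℝ} (hx : 0 < x) : 0 < besselK ν x := by
  have hpos : ∀ t, 0 < Real.exp (-x * Real.cosh t) * Real.cosh (ν * t) := fun t =>
    mul_pos (Real.exp_pos _) (Real.cosh_pos _)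
  rw [besselK, integral_pos_iff_support_of_nonneg (fun t => (hpos t).le)
    (integrableOn_besselK ν hx), Function.support_eq_univ fun t => (hpos t).ne']
  simp

theorem tendsto_exp_cosh_mul_sinh (ν : ℝ) {x : ℝ} (hx : 0 < x) :
    Tendsto (fun t => Real.exp (-x * Real.cosh t) * Real.sinh (ν * t)) atTop (𝓝 0) := by
  have h := Real.tendsto_exp_neg_atTop_nhds_zero.const_mul (Real.exp ((|ν| + 1) ^ 2 / x))
  rw [mul_zero] at h
  refine squeeze_zero_norm' ?_ h
  filter_upwards [eventually_ge_atTop 0] with t ht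
  refine le_trans ?_ (besselK_integrand_le ν hx ht)
  rw [norm_mul, Real.norm_of_nonneg (Real.exp_pos _).le]
  refine mul_le_mul_of_nonneg_left ?_ (Real.exp_pos _).le
  rw [Real.norm_eq_abs]
  exact abs_le.2 (abs_le_of_sq_le_sq' (by linarith [Real.cosh_sq (ν * t)]) (Real.cosh_pos _).le)

theorem cosh_mul_cosh_mul (ν t : ℝ) : Real.cosh t * Real.cosh (ν * t)
    = (Real.cosh ((ν + 1) * t) + Real.cosh ((ν - 1) * t)) / 2 := by
  rw [add_mul, sub_mul, one_mul, Real.cosh_add, Real.cosh_sub]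
  ring

theorem sinh_mul_sinh_mul (ν t : ℝ) : Real.sinh t * Real.sinh (ν * t)
    = (Real.cosh ((ν + 1) * t) - Real.cosh ((ν - 1) * t)) / 2 := by
  rw [add_mul, sub_mul, one_mul, Real.cosh_add, Real.cosh_sub]
  ring

/-- Integrate the derivative of e^(-x cosh t) sinh(νt) over (0, ∞): both boundary terms vanish. -/
theorem besselK_add_one_sub (ν : ℝ) {x : ℝ} (hx : 0 < x) :
    x * (besselK (ν + 1) x - besselK (ν - 1) x) = 2 * ν * besselK ν x := by
  have i0 := (integrableOn_besselK ν hx).const_mul ν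
  have i1 : IntegrableOn (fun t => x / 2 * (Real.exp (-x * Real.cosh t) * Real.cosh ((ν + 1) * t)
      - Real.exp (-x * Real.cosh t) * Real.cosh ((ν - 1) * t))) (Ioi 0) :=
    ((integrableOn_besselK (ν + 1) hx).sub (integrableOn_besselK (ν - 1) hx)).const_mul (x / 2)
  have hd : ∀ t ∈ Ici (0 : ℝ), HasDerivAt
      (fun t => Real.exp (-x * Real.cosh t) * Real.sinh (ν * t))
      (ν * (Real.exp (-x * Real.cosh t) * Real.cosh (ν * t))
        - x / 2 * (Real.exp (-x * Real.cosh t) * Real.cosh ((ν + 1) * t)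
          - Real.exp (-x * Real.cosh t) * Real.cosh ((ν - 1) * t))) t := by
    intro t _
    have h1 := ((Real.hasDerivAt_cosh t).const_mul (-x)).exp
    have h2 := ((hasDerivAt_id t).const_mul ν).sinh
    refine (h1.mul h2).congr_deriv ?_
    simp only [id]
    linear_combination (-x * Real.exp (-x * Real.cosh t)) * sinh_mul_sinh_mul ν t
  have h := integral_Ioi_of_hasDerivAt_of_tendsto' hd (i0.sub i1)
    (tendsto_exp_cosh_mul_sinh ν hx)
  rw [integral_sub i0 i1, integral_const_mul, integral_const_mul,
    integral_sub (integrableOn_besselK (ν + 1) hx) (integrableOn_besselK (ν - 1) hx)] at h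
  simp only [mul_zero, Real.sinh_zero, sub_zero] at h
  simp only [besselK]
  linarith

theorem hasDerivAt_besselK (ν : ℝ) {x : ℝ} (hx : 0 < x) :
    HasDerivAt (besselK ν) (-((besselK (ν + 1) x + besselK (ν - 1) x) / 2)) x := by
  have hx2 : 0 < x / 2 := by positivity
  -- For y > x/2 the differentiated integrand is dominated by its absolute value at y = x/2.
  have hbi : IntegrableOn (fun t => (Real.exp (-(x / 2) * Real.cosh t) * Real.cosh ((ν + 1) * t)
      + Real.exp (-(x / 2) * Real.cosh t) * Real.cosh ((ν - 1) * t)) / 2) (Ioi 0) :=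
    ((integrableOn_besselK (ν + 1) hx2).add (integrableOn_besselK (ν - 1) hx2)).div_const 2
  have h := (hasDerivAt_integral_of_dominated_loc_of_deriv_le
    (μ := volume.restrict (Ioi (0 : ℝ)))
    (F := fun y t => Real.exp (-y * Real.cosh t) * Real.cosh (ν * t))
    (F' := fun y t => -((Real.exp (-y * Real.cosh t) * Real.cosh ((ν + 1) * t)
      + Real.exp (-y * Real.cosh t) * Real.cosh ((ν - 1) * t)) / 2))
    (Ioi_mem_nhds (half_lt_self hx))
    (Eventually.of_forall fun y => by fun_prop) (integrableOn_besselK ν hx)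
    (by fun_prop) (Eventually.of_forall fun t y hy => ?_) hbi
    (Eventually.of_forall fun t y _ => ?_)).2
  · refine h.congr_deriv ?_
    rw [integral_neg, integral_div,
      integral_add (integrableOn_besselK (ν + 1) hx) (integrableOn_besselK (ν - 1) hx)]
    rfl
  · have c1 := Real.cosh_pos ((ν + 1) * t)
    have c2 := Real.cosh_pos ((ν - 1) * t)
    have he : Real.exp (-y * Real.cosh t) ≤ Real.exp (-(x / 2) * Real.cosh t) := by
      rw [Real.exp_le_exp]
      have := mul_le_mul_of_nonneg_right (le_of_lt hy) (Real.cosh_pos t).le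
      linarith
    rw [norm_neg, Real.norm_of_nonneg (by positivity)]
    gcongr
  · have h1 := ((hasDerivAt_neg y).mul_const (Real.cosh t)).exp.mul_const (Real.cosh (ν * t))
    refine h1.congr_deriv ?_
    linear_combination (-Real.exp (-y * Real.cosh t)) * cosh_mul_cosh_mul ν t

theorem hasDerivAt_besselK_div_rpow (ν : ℝ) {x : ℝ} (hx : 0 < x) :
    HasDerivAt (fun y => besselK ν y / y ^ ν) (-(x * (besselK (ν + 1) x / x ^ (ν + 1)))) x := by
  have hp : 0 < x ^ ν := Real.rpow_pos_of_pos hx ν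
  refine ((hasDerivAt_besselK ν hx).div (Real.hasDerivAt_rpow_const (Or.inl hx.ne'))
    hp.ne').congr_deriv ?_
  rw [Real.rpow_sub_one hx.ne', Real.rpow_add_one hx.ne']
  have := besselK_add_one_sub ν hx
  field_simp
  linarith

theorem besselK_add_two_div_rpow (ν : ℝ) {x : ℝ} (hx : 0 < x) :
    x ^ 2 * (besselK (ν + 1 + 1) x / x ^ (ν + 1 + 1))
      = besselK ν x / x ^ ν + 2 * (ν + 1) * (besselK (ν + 1) x / x ^ (ν + 1)) := by
  have hp : 0 < x ^ ν := Real.rpow_pos_of_pos hx ν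
  rw [Real.rpow_add_one hx.ne', Real.rpow_add_one hx.ne']
  have h := besselK_add_one_sub (ν + 1) hx
  rw [add_sub_cancel_right] at h
  field_simp
  linarith

/-- The `n`-th derivative of `K_ν(y) / y ^ ν`, in terms of functions of higher order. -/
noncomputable def besselKQuotDeriv : ℕ → ℝ → ℝ → ℝ
  | 0, ν, y => besselK ν y / y ^ ν
  | 1, ν, y => -(y * (besselK (ν + 1) y / y ^ (ν + 1)))
  | n + 2, ν, y => besselKQuotDeriv n ν y + (2 * ν + 1) * besselKQuotDeriv n (ν + 1) y

/-- The second-order relation for f_ν is checked only at n = 1; higher orders follow by linearity.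
-/
theorem hasDerivAt_besselKQuotDeriv (n : ℕ) : ∀ (ν y : ℝ), 0 < y →
    HasDerivAt (besselKQuotDeriv n ν) (besselKQuotDeriv (n + 1) ν y) y := by
  induction n using Nat.twoStepInduction with
  | zero => exact fun ν y hy => hasDerivAt_besselK_div_rpow ν hy
  | one =>
    intro ν y hy
    refine ((hasDerivAt_id y).mul (hasDerivAt_besselK_div_rpow (ν + 1) hy)).neg.congr_deriv ?_
    have := besselK_add_two_div_rpow ν hy
    simp only [besselKQuotDeriv, id]
    linarith
  | more n ih _ =>
    exact fun ν y hy => (ih ν y hy).add ((ih (ν + 1) y hy).const_mul (2 * ν + 1))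

theorem neg_one_pow_mul_besselKQuotDeriv_pos (n : ℕ) : ∀ (ν y : ℝ), -(1 / 2 : ℝ) ≤ ν → 0 < y →
    0 < (-1) ^ n * besselKQuotDeriv n ν y := by
  induction n using Nat.twoStepInduction with
  | zero =>
    intro ν y _ hy
    have := besselK_pos ν hy
    simp only [besselKQuotDeriv]
    positivity
  | one =>
    intro ν y _ hy
    have := besselK_pos (ν + 1) hy
    simp only [besselKQuotDeriv, pow_one, neg_mul_neg, one_mul]
    positivity
  | more n ih _ =>
    intro ν y hν hy
    have h1 := ih ν y hν hy
    have h2 := mul_nonneg (by linarith : 0 ≤ 2 * ν + 1) (ih (ν + 1) y (by linarith) hy).le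
    simp only [besselKQuotDeriv, pow_add]
    linarith

theorem neg_one_pow_mul_besselKQuotDeriv_le (n : ℕ) : ∀ (ν y : ℝ), -(1 / 2 : ℝ) ≤ ν → 0 < y →
    (-1) ^ n * besselKQuotDeriv n ν y ≤ besselK (ν + n) y / y ^ ν := by
  induction n using Nat.twoStepInduction with
  | zero => intro ν y _ _; simp [besselKQuotDeriv]
  | one =>
    intro ν y _ hy
    have hp : 0 < y ^ ν := Real.rpow_pos_of_pos hy ν
    simp only [besselKQuotDeriv, Real.rpow_add_one hy.ne', Nat.cast_one]
    apply le_of_eq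
    field_simp
  | more n ih _ =>
    intro ν y hν hy
    have hp : 0 < y ^ ν := Real.rpow_pos_of_pos hy ν
    have h1 := ih ν y hν hy
    have h2 := mul_le_mul_of_nonneg_left (ih (ν + 1) y (by linarith) hy)
      (by linarith : 0 ≤ 2 * ν + 1)
    have hK := besselK_pos (ν + n + 1) hy
    have hrec := besselK_add_one_sub (ν + n + 1) hy
    rw [add_sub_cancel_right] at hrec
    have hn : (0 : ℝ) ≤ n := n.cast_nonneg
    -- By the recurrence, K_{ν+n+2} = K_{ν+n} + (2(ν+n+1)/y) K_{ν+n+1}, and 2ν+1 ≤ 2(ν+n+1).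
    have h3 : besselK (ν + n) y / y ^ ν
        + (2 * ν + 1) * (besselK (ν + n + 1) y / (y ^ ν * y))
        ≤ besselK (ν + n + 1 + 1) y / y ^ ν := by
      field_simp
      nlinarith
    rw [show ν + 1 + (n : ℝ) = ν + n + 1 by ring, Real.rpow_add_one hy.ne'] at h2
    rw [show ν + ((n + 2 : ℕ) : ℝ) = ν + n + 1 + 1 by push_cast; ring]
    simp only [besselKQuotDeriv, pow_add]
    linarith

theorem iteratedDeriv_besselK_div_rpow (n : ℕ) (ν : ℝ) {x : ℝ} (hx : 0 < x) :
    iteratedDeriv n (fun y => besselK ν y / y ^ ν) x = besselKQuotDeriv n ν x :=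
  iteratedDeriv_eq_of_hasDerivAt_Ioi (g := fun n => besselKQuotDeriv n ν)
    (fun _ _ => rfl) (fun n y hy => hasDerivAt_besselKQuotDeriv n ν y hy) n x hx

/-! ### Exponential generating functions -/

/-- The exponential generating function `∑ c_j x^j / j!` of a real sequence. -/
noncomputable def expGenFun (c : ℕ → ℝ) (x : ℝ) : ℝ := ∑' j, c j * (x ^ j / j.factorial)

theorem summable_expGenFun {c : ℕ → ℝ} {M : ℝ} (hc : ∀ j, |c j| ≤ M) (x : ℝ) :
    Summable fun j => c j * (x ^ j / j.factorial) := by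
  refine Summable.of_norm_bounded ((Real.summable_pow_div_factorial |x|).mul_left M) fun j => ?_
  rw [norm_mul, Real.norm_eq_abs, Real.norm_eq_abs, abs_div, abs_pow, Nat.abs_cast]
  exact mul_le_mul_of_nonneg_right (hc j) (by positivity)

theorem hasDerivAt_expGenFun {c : ℕ → ℝ} {M : ℝ} (hc : ∀ j, |c j| ≤ M) (x : ℝ) :
    HasDerivAt (expGenFun c) (expGenFun (fun j => c (j + 1)) x) x := by
  have hM : 0 ≤ M := (abs_nonneg _).trans (hc 0)
  set g' : ℕ → ℝ → ℝ := fun j y => c j * (j * y ^ (j - 1) / j.factorial) with hg'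
  have hshift : ∀ (j : ℕ) (y : ℝ), ((j + 1 : ℕ) : ℝ) * y ^ (j + 1 - 1) / (j + 1).factorial
      = y ^ j / j.factorial := by
    intro j y
    rw [Nat.factorial_succ, Nat.cast_mul, Nat.add_sub_cancel,
      mul_div_mul_left _ _ (by positivity)]
  have hu : Summable fun j : ℕ => M * (j * (|x| + 1) ^ (j - 1) / j.factorial) := by
    rw [← summable_nat_add_iff 1]
    simp only [hshift]
    exact (Real.summable_pow_div_factorial _).mul_left M
  have hs : Summable fun j => g' j x := by
    rw [← summable_nat_add_iff 1]
    simp only [hg', hshift]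
    exact summable_expGenFun (fun j => hc (j + 1)) x
  have hmem : x ∈ Metric.ball (0 : ℝ) (|x| + 1) := by simp
  have h := hasDerivAt_tsum_of_isPreconnected (g := fun j y => c j * (y ^ j / j.factorial))
    (g' := g') hu Metric.isOpen_ball (convex_ball (0 : ℝ) (|x| + 1)).isPreconnected
    (fun j y _ => ((hasDerivAt_pow j y).div_const _).const_mul (c j)) (fun j y hy => ?_) hmem
    (summable_expGenFun hc x) hmem
  · refine h.congr_deriv ?_
    -- The term j = 0 vanishes through its factor j, so the truncated exponent `0 - 1` is harmless.
    rw [hs.tsum_eq_zero_add]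
    simp only [hg', hshift]
    simp [expGenFun]
  · rw [mem_ball_zero_iff, Real.norm_eq_abs] at hy
    rw [hg', norm_mul, Real.norm_eq_abs, Real.norm_eq_abs, abs_div, abs_mul, abs_pow,
      Nat.abs_cast, Nat.abs_cast]
    have := hc j
    gcongr

theorem expGenFun_mono {c d : ℕ → ℝ} {M N : ℝ} (hc : ∀ j, |c j| ≤ M) (hd : ∀ j, |d j| ≤ N)
    (h : ∀ j, c j ≤ d j) {x : ℝ} (hx : 0 ≤ x) : expGenFun c x ≤ expGenFun d x :=
  (summable_expGenFun hc x).tsum_le_tsum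
    (fun j => mul_le_mul_of_nonneg_right (h j) (by positivity)) (summable_expGenFun hd x)

theorem expGenFun_pos {c : ℕ → ℝ} {M : ℝ} (hc : ∀ j, |c j| ≤ M) (h0 : ∀ j, 0 ≤ c j) {i : ℕ}
    (hi : 0 < c i) {x : ℝ} (hx : 0 < x) : 0 < expGenFun c x :=
  (summable_expGenFun hc x).tsum_pos (fun j => mul_nonneg (h0 j) (by positivity)) i
    (by positivity)

/-! ### The function of the first kind -/

/-- The even-indexed coefficients of `I_ν(x) / x ^ ν` as an exponential generating function. -/
noncomputable def besselICoeff (ν : ℝ) (k : ℕ) : ℝ :=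
  (2 * k).factorial * (1 / 2 : ℝ) ^ (2 * (k : ℝ) + ν) / (k.factorial * Real.Gamma (ν + k + 1))

theorem besselICoeff_pos {ν : ℝ} (hν : -(1 / 2 : ℝ) ≤ ν) (k : ℕ) : 0 < besselICoeff ν k := by
  have hk : (0 : ℝ) ≤ k := k.cast_nonneg
  have := Real.Gamma_pos_of_pos (show 0 < ν + k + 1 by linarith)
  unfold besselICoeff
  positivity

theorem besselICoeff_succ {ν : ℝ} (hν : -(1 / 2 : ℝ) ≤ ν) (k : ℕ) :
    besselICoeff ν (k + 1) = besselICoeff ν k * ((2 * k + 1) / (2 * (ν + k + 1))) := by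
  have hk : (0 : ℝ) ≤ k := k.cast_nonneg
  have hpos : 0 < ν + k + 1 := by linarith
  have hG := Real.Gamma_pos_of_pos hpos
  unfold besselICoeff
  rw [show 2 * (k + 1) = 2 * k + 1 + 1 by ring, Nat.factorial_succ, Nat.factorial_succ,
    Nat.factorial_succ, Nat.cast_succ, show ν + ((k : ℝ) + 1) + 1 = ν + k + 1 + 1 by ring,
    Real.Gamma_add_one hpos.ne',
    show 2 * ((k : ℝ) + 1) + ν = 2 * (k : ℝ) + ν + 1 + 1 by ring,
    Real.rpow_add_one (by norm_num), Real.rpow_add_one (by norm_num)]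
  push_cast
  field_simp
  ring

/-- The ratio (2k+1)/(2(ν+k+1)) is at most 1 exactly because ν ≥ -1/2. -/
theorem besselICoeff_antitone {ν : ℝ} (hν : -(1 / 2 : ℝ) ≤ ν) : Antitone (besselICoeff ν) := by
  refine antitone_nat_of_succ_le fun k => ?_
  have hk : (0 : ℝ) ≤ k := k.cast_nonneg
  rw [besselICoeff_succ hν]
  refine mul_le_of_le_one_right (besselICoeff_pos hν k).le ?_
  rw [div_le_one (by linarith)]
  linarith

/-- The coefficients of `I_ν(x) / x ^ ν` as an exponential generating function. -/
noncomputable def besselISeq (ν : ℝ) (j : ℕ) : ℝ :=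
  if Even j then besselICoeff ν (j / 2) else 0

theorem besselISeq_two_mul (ν : ℝ) (k : ℕ) : besselISeq ν (2 * k) = besselICoeff ν k := by
  simp [besselISeq]

theorem besselISeq_two_mul_add_one (ν : ℝ) (k : ℕ) : besselISeq ν (2 * k + 1) = 0 := by
  simp [besselISeq]

theorem besselISeq_nonneg {ν : ℝ} (hν : -(1 / 2 : ℝ) ≤ ν) (j : ℕ) : 0 ≤ besselISeq ν j := by
  unfold besselISeq
  split_ifs
  exacts [(besselICoeff_pos hν _).le, le_rfl]

theorem abs_besselISeq_le {ν : ℝ} (hν : -(1 / 2 : ℝ) ≤ ν) (j : ℕ) :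
    |besselISeq ν j| ≤ besselICoeff ν 0 := by
  rw [abs_of_nonneg (besselISeq_nonneg hν j)]
  unfold besselISeq
  split_ifs
  exacts [besselICoeff_antitone hν (Nat.zero_le _), (besselICoeff_pos hν 0).le]

theorem besselISeq_add_two_mul_le {ν : ℝ} (hν : -(1 / 2 : ℝ) ≤ ν) (j m : ℕ) :
    besselISeq ν (j + 2 * m) ≤ besselISeq ν j := by
  simp only [besselISeq, Nat.even_add, even_two_mul, iff_true]
  split_ifs
  exacts [besselICoeff_antitone hν (by omega), le_rfl]

theorem tsum_eq_tsum_two_mul {F : ℕ → ℝ} (hF : ∀ k, F (2 * k + 1) = 0) :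
    ∑' j, F j = ∑' k, F (2 * k) := by
  refine ((mul_right_injective₀ (two_ne_zero' ℕ)).tsum_eq fun j hj => ?_).symm
  obtain ⟨k, rfl | rfl⟩ := j.even_or_odd'
  exacts [⟨k, rfl⟩, absurd (hF k) hj]

theorem tsum_eq_tsum_two_mul_add_one {F : ℕ → ℝ} (hF : ∀ k, F (2 * k) = 0) :
    ∑' j, F j = ∑' k, F (2 * k + 1) := by
  have hinj : Function.Injective fun k : ℕ => 2 * k + 1 := fun a b h => by
    simp only at h
    omega
  refine (hinj.tsum_eq fun j hj => ?_).symm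
  obtain ⟨k, rfl | rfl⟩ := j.even_or_odd'
  exacts [absurd (hF k) hj, ⟨k, rfl⟩]

theorem besselI_div_rpow_eq (ν : ℝ) {x : ℝ} (hx : 0 < x) :
    besselI ν x / x ^ ν = expGenFun (besselISeq ν) x := by
  rw [expGenFun, tsum_eq_tsum_two_mul fun k => by rw [besselISeq_two_mul_add_one, zero_mul]]
  simp only [besselISeq_two_mul]
  rw [besselI, ← tsum_div_const]
  refine tsum_congr fun k => ?_
  have hp : 0 < x ^ ν := Real.rpow_pos_of_pos hx ν
  rw [show x / 2 = x * (1 / 2) by ring, Real.mul_rpow hx.le (by norm_num), besselICoeff,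
    Real.rpow_add hx, show 2 * (k : ℝ) = ((2 * k : ℕ) : ℝ) by push_cast; ring, Real.rpow_natCast]
  field_simp

/-- Termwise, the factor 2k+2 of (2k+2)! cancels k+1 from (k+1)! and one factor 1/2. -/
theorem rpow_neg_mul_besselI_add_one_eq {ν : ℝ} (hν : -(1 / 2 : ℝ) ≤ ν) {x : ℝ} (hx : 0 < x) :
    x ^ (-ν) * besselI (ν + 1) x = expGenFun (fun j => besselISeq ν (j + 1)) x := by
  rw [expGenFun,
    tsum_eq_tsum_two_mul_add_one fun k => by rw [besselISeq_two_mul_add_one, zero_mul]]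
  simp only [show ∀ k, 2 * k + 1 + 1 = 2 * (k + 1) from fun k => by ring, besselISeq_two_mul]
  rw [besselI, ← tsum_mul_left]
  refine tsum_congr fun k => ?_
  have hk : (0 : ℝ) ≤ k := k.cast_nonneg
  have hp : 0 < x ^ ν := Real.rpow_pos_of_pos hx ν
  have hG := Real.Gamma_pos_of_pos (show 0 < ν + 1 + k + 1 by linarith)
  rw [show x / 2 = x * (1 / 2) by ring, Real.mul_rpow hx.le (by norm_num), besselICoeff,
    Real.rpow_neg hx.le,
    show 2 * (((k + 1 : ℕ)) : ℝ) + ν = 2 * (k : ℝ) + (ν + 1) + 1 by push_cast; ring,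
    Real.rpow_add_one (by norm_num : (1 / 2 : ℝ) ≠ 0),
    show ν + ((k + 1 : ℕ) : ℝ) + 1 = ν + 1 + k + 1 by push_cast; ring,
    show 2 * (k + 1) = 2 * k + 1 + 1 by ring, Nat.factorial_succ (2 * k + 1),
    Nat.factorial_succ k, Real.rpow_add hx, Real.rpow_add_one hx.ne',
    show x ^ (2 * (k : ℝ)) = x ^ (2 * k) by
      rw [← Real.rpow_natCast]; push_cast; rfl]
  push_cast
  field_simp
  ring

theorem iteratedDeriv_besselI_div_rpow {ν : ℝ} (hν : -(1 / 2 : ℝ) ≤ ν) (n : ℕ) {x : ℝ}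
    (hx : 0 < x) : iteratedDeriv n (fun y => besselI ν y / y ^ ν) x
      = expGenFun (fun j => besselISeq ν (j + n)) x := by
  refine iteratedDeriv_eq_of_hasDerivAt_Ioi
    (g := fun n => expGenFun (fun j => besselISeq ν (j + n)))
    (fun y hy => besselI_div_rpow_eq ν hy) (fun n y _ => ?_) n x hx
  refine (hasDerivAt_expGenFun (fun j => abs_besselISeq_le hν (j + n)) y).congr_deriv ?_
  simp only [add_assoc, add_comm 1 n]

theorem iteratedDeriv_besselI_div_rpow_pos {ν : ℝ} (hν : -(1 / 2 : ℝ) ≤ ν) (n : ℕ) {x : ℝ}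
    (hx : 0 < x) : 0 < iteratedDeriv n (fun y => besselI ν y / y ^ ν) x := by
  rw [iteratedDeriv_besselI_div_rpow hν n hx]
  -- The index j = n makes j + n even, so its coefficient is positive for either parity of n.
  refine expGenFun_pos (fun j => abs_besselISeq_le hν (j + n))
    (fun j => besselISeq_nonneg hν (j + n)) (i := n) ?_ hx
  rw [← two_mul, besselISeq_two_mul]
  exact besselICoeff_pos hν n

theorem iteratedDeriv_besselI_div_rpow_le {ν : ℝ} (hν : -(1 / 2 : ℝ) ≤ ν) (n : ℕ) {x : ℝ}
    (hx : 0 < x) : iteratedDeriv n (fun y => besselI ν y / y ^ ν) x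
      ≤ if Odd n then x ^ (-ν) * besselI (ν + 1) x else x ^ (-ν) * besselI ν x := by
  rw [iteratedDeriv_besselI_div_rpow hν n hx]
  have hb := fun n j => abs_besselISeq_le hν (j + n)
  split_ifs with hn
  · obtain ⟨m, rfl⟩ := hn
    rw [rpow_neg_mul_besselI_add_one_eq hν hx]
    refine expGenFun_mono (hb _) (hb 1) (fun j => ?_) hx.le
    rw [show j + (2 * m + 1) = j + 1 + 2 * m by ring]
    exact besselISeq_add_two_mul_le hν (j + 1) m
  · obtain ⟨m, rfl⟩ := even_iff_exists_two_mul.1 (Nat.not_odd_iff_even.1 hn)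
    rw [Real.rpow_neg hx.le, inv_mul_eq_div, besselI_div_rpow_eq ν hx]
    exact expGenFun_mono (hb _) (hb 0) (fun j => besselISeq_add_two_mul_le hν j m) hx.le

theorem corollary3p4 (n : ℕ) (ν x : ℝ) (hν : -(1 / 2 : ℝ) ≤ ν) (hx : 0 < x) :
    (0 < iteratedDeriv (2 * n) (fun y : ℝ => besselK ν y / y ^ ν) x ∧
      iteratedDeriv (2 * n) (fun y : ℝ => besselK ν y / y ^ ν) x
        ≤ besselK (ν + 2 * (n : ℝ)) x / x ^ ν) ∧
    (-(besselK (ν + 2 * (n : ℝ) + 1) x / x ^ ν)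
        ≤ iteratedDeriv (2 * n + 1) (fun y : ℝ => besselK ν y / y ^ ν) x ∧
      iteratedDeriv (2 * n + 1) (fun y : ℝ => besselK ν y / y ^ ν) x < 0) ∧
    (0 < iteratedDeriv n (fun y : ℝ => besselI ν y / y ^ ν) x ∧
      iteratedDeriv n (fun y : ℝ => besselI ν y / y ^ ν) x
        ≤ if Odd n then x ^ (-ν) * besselI (ν + 1) x else x ^ (-ν) * besselI ν x) := by
  have h1 := neg_one_pow_mul_besselKQuotDeriv_pos (2 * n) ν x hν hx
  have h2 := neg_one_pow_mul_besselKQuotDeriv_le (2 * n) ν x hν hx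
  have h3 := neg_one_pow_mul_besselKQuotDeriv_pos (2 * n + 1) ν x hν hx
  have h4 := neg_one_pow_mul_besselKQuotDeriv_le (2 * n + 1) ν x hν hx
  simp only [pow_succ _ (2 * n), (even_two_mul n).neg_one_pow, one_mul, neg_one_mul] at h1 h2 h3 h4
  push_cast at h2 h4
  rw [← add_assoc] at h4
  rw [iteratedDeriv_besselK_div_rpow _ ν hx, iteratedDeriv_besselK_div_rpow _ ν hx]
  exact ⟨⟨h1, h2⟩, ⟨by linarith, by linarith⟩,
    iteratedDeriv_besselI_div_rpow_pos hν n hx, iteratedDeriv_besselI_div_rpow_le hν n hx⟩
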